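/- Let $n\ge 0$ and let $\mathcal{C}\ell_n$ be the real Clifford algebra generated by $e_1,\dots,e_n$ with $e_ie_j+e_je_i=-2\delta_{ij}$, normed by $|\sum_A a_Ae_A|^2=\sum_A a_A^2$. Let $M:\mathcal{C}\ell_n\to\mathcal{C}\ell_n$ be a bounded real-linear operator commuting with left multiplication by each $e_j$ (for example right multiplication $M_\lambda a=a\lambda$ by a Clifford number $\lambda$). For an open set $\Omega\subseteq\mathbb{R}^{n+1}$, with coordinates $y_0,\dots,y_n$, let $\mathcal{M}_M(\Omega)$ be the set of $C^1$ functions $f:\Omega\to\mathcal{C}\ell_n$ satisfying $$\frac{\partial f}{\partial y_0}=\Bigl(\sum_{j=1}^n e_j\frac{\partial}{\partial y_j}+M\Bigr)f\quad\text{in }\Omega .$$ Weierstrass' Theorem: let $(f_k)_{k\in\mathbb{N}}$ be a sequence in $\mathcal{M}_M(\Omega)$ that converges to a function $f:\Omega\to\mathcal{C}\ell_n$ uniformly on each compact subset of $\Omega$. Then 1. $f\in\mathcal{M}_M(\Omega)$. 2. All $f_k$ and $f$ are $C^\infty$ on $\Omega$ and, for each multi-index $\beta=(\beta_0,\dots,\beta_n)\in\mathbb{N}^{n+1}$,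 the sequence $(\partial^\beta f_k)_{k\in\mathbb{N}}$ converges to $\partial^\beta f$ uniformly on each compact subset of $\Omega$. -/

import Mathlib

namespace CliffordAnalysis

/-- The negative definite quadratic form `x ↦ -(x₁² + ⋯ + xₙ²)` on `ℝⁿ`. -/
noncomputable def negSq (n : ℕ) : QuadraticForm ℝ (Fin n → ℝ) :=
  QuadraticMap.weightedSumSquares ℝ (fun _ : Fin n => (-1 : ℝ))

/-- The real Clifford algebra with `n` generators squaring to `-1`. -/
abbrev Cl (n : ℕ) : Type := CliffordAlgebra (negSq n)

/-- The generators `e₁, …, eₙ` (indexed by `Fin n`, that is, from `0`). -/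
noncomputable def e {n : ℕ} (j : Fin n) : Cl n :=
  CliffordAlgebra.ι (negSq n) (Pi.single j 1)

theorem e_anticomm {n : ℕ} (i j : Fin n) :
    (e i * e j + e j * e i : Cl n) = algebraMap ℝ (Cl n) (if i = j then -2 else 0) := by
  unfold e
  rw [CliffordAlgebra.ι_mul_ι_add_swap]
  congr 1
  simp only [QuadraticMap.polar, negSq, QuadraticMap.weightedSumSquares_apply, Pi.add_apply,
    smul_eq_mul, ← Finset.sum_sub_distrib]
  have key : ∀ k : Fin n,
      (-1 * (((Pi.single i 1 : Fin n → ℝ) k + (Pi.single j 1 : Fin n → ℝ) k) *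
        ((Pi.single i 1 : Fin n → ℝ) k + (Pi.single j 1 : Fin n → ℝ) k)) -
        -1 * ((Pi.single i 1 : Fin n → ℝ) k * (Pi.single i 1 : Fin n → ℝ) k) -
        -1 * ((Pi.single j 1 : Fin n → ℝ) k * (Pi.single j 1 : Fin n → ℝ) k) : ℝ) =
      (Pi.single i 1 : Fin n → ℝ) k * (-2 * (Pi.single j 1 : Fin n → ℝ) k) := by
    intro k; ring
  rw [Finset.sum_congr rfl (fun k _ => key k)]
  by_cases h : i = j
  · subst h
    simp [Pi.single_apply]
  · have h2 : ¬ j = i := fun h2 => h h2.symm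
    simp [h, h2, Pi.single_apply]

/-- The basis `(e_A)` of the Clifford algebra, indexed by the subsets `A` of the set of generators:
it is the standard basis of the exterior algebra carried over by the canonical linear
isomorphism, which takes `e_{i₁} ∧ ⋯ ∧ e_{iₖ}` (`i₁ < ⋯ < iₖ`) to `e_{i₁} ⋯ e_{iₖ}`. -/
noncomputable def clBasis (n : ℕ) : Module.Basis (Finset (Fin n)) ℝ (Cl n) :=
  (Pi.basisFun ℝ (Fin n)).ExteriorAlgebra.map (CliffordAlgebra.equivExterior (negSq n)).symm

/-- The coordinates `(a_A)` of a Clifford number `a = ∑ a_A e_A`. -/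
noncomputable def clCoord (n : ℕ) : Cl n ≃ₗ[ℝ] EuclideanSpace ℝ (Finset (Fin n)) :=
  (clBasis n).equivFun.trans (WithLp.linearEquiv 2 ℝ (Finset (Fin n) → ℝ)).symm

/-- The usual norm of a Clifford number, `|a|² = ∑ a_A²`. -/
noncomputable instance instNormedAddCommGroupCl (n : ℕ) : NormedAddCommGroup (Cl n) :=
  NormedAddCommGroup.induced (Cl n) (EuclideanSpace ℝ (Finset (Fin n))) (clCoord n)
    (clCoord n).injective

noncomputable instance instNormedSpaceCl (n : ℕ) : NormedSpace ℝ (Cl n) :=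
  NormedSpace.induced ℝ (Cl n) (EuclideanSpace ℝ (Finset (Fin n))) (clCoord n)

/-- The partial derivative `∂ᵢ f` of a function on `ℝⁿ⁺¹` with coordinates `y₀, …, yₙ`. -/
noncomputable def partialDeriv {n : ℕ} (i : Fin (n + 1))
    (f : EuclideanSpace ℝ (Fin (n + 1)) → Cl n) : EuclideanSpace ℝ (Fin (n + 1)) → Cl n :=
  fun y => lineDeriv ℝ f y (EuclideanSpace.single i 1)

/-- `∂^β f = ∂₀^{β₀} ∂₁^{β₁} ⋯ ∂ₙ^{βₙ} f` for a multi-index `β`. -/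
noncomputable def multiDeriv {n : ℕ} (β : Fin (n + 1) → ℕ)
    (f : EuclideanSpace ℝ (Fin (n + 1)) → Cl n) : EuclideanSpace ℝ (Fin (n + 1)) → Cl n :=
  (List.finRange (n + 1)).foldr (fun i g => (partialDeriv i)^[β i] g) f

/-- The (classical, `C¹`) solutions on `Ω` of `∂f/∂y₀ = (∑ⱼ eⱼ ∂/∂yⱼ + M) f`.
Only the values of `f` on `Ω` matter when `Ω` is open. -/
def solutionSpace {n : ℕ} (M : Cl n →L[ℝ] Cl n) (Ω : Set (EuclideanSpace ℝ (Fin (n + 1)))) :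
    Set (EuclideanSpace ℝ (Fin (n + 1)) → Cl n) :=
  {f | ContDiffOn ℝ 1 f Ω ∧ ∀ y ∈ Ω,
    partialDeriv 0 f y = ∑ j : Fin n, e j * partialDeriv j.succ f y + M (f y)}

/-- Uniform convergence on every compact subset of `Ω`. -/
def ConvergesUniformlyOnCompacts {n : ℕ} (g : ℕ → EuclideanSpace ℝ (Fin (n + 1)) → Cl n)
    (h : EuclideanSpace ℝ (Fin (n + 1)) → Cl n) (Ω : Set (EuclideanSpace ℝ (Fin (n + 1)))) :
    Prop :=
  ∀ K : Set (EuclideanSpace ℝ (Fin (n + 1))), K ⊆ Ω → IsCompact K →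
    TendstoUniformlyOn g h Filter.atTop K

end CliffordAnalysis

open MeasureTheory Metric Topology Set Filter
open scoped ContDiff Convolution

/-! The equation reads `∑ βᵢ ∂ᵢ f = M f` with `β₀ = 1`, `βⱼ = -eⱼ`. With the conjugate coefficients
`α₀ = 1`, `αⱼ = eⱼ` one has `αᵢ βⱼ + αⱼ βᵢ = 2δᵢⱼ`, so the operator `∑ βᵢ ∂ᵢ` is a factor of the
Laplacian. As `M` commutes with the `βᵢ`, the integrating factor `exp (-y₀ M)` reduces the equation
to `M = 0`, where a mean value property holds against radial weights. It is proved for `C¹`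
functions directly, by one integration by parts (`radial_moment_symm`,
`integral_radial_smul_sub_eq`), so no second derivatives are needed.

Undoing the factor shows that every solution is locally its own convolution with one smooth
compactly supported kernel, the same for all solutions (`exists_reproducing_kernel`). The identity
survives uniform limits, and derivatives may be put on the kernel: the limit is smooth and first
derivatives converge locally uniformly (`weierstrass_local`). Hence the limit solves the equation.
Partial derivatives of solutions are again solutions, so induction reaches every multi-index. -/

namespace CliffordAnalysis

/-! ### Mean value property for radial weights -/

section


variable {ι : Type*} [Fintype ι] [DecidableEq ι]

/-- Smooth radial functions of mass one with arbitrarily small support. -/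
theorem exists_radial_mollifier (ι : Type*) [Fintype ι] {r : ℝ} (hr : 0 < r) :
    ∃ φ a : EuclideanSpace ℝ ι → ℝ, ContDiff ℝ ∞ φ ∧ tsupport φ ⊆ closedBall 0 r ∧
      ∫ t, φ t = 1 ∧ ∀ t, HasFDerivAt φ (a t • innerSL ℝ t) t := by
  -- Composing a bump with `‖t‖ ^ 2` rather than `‖t‖` keeps smoothness at the origin and makes the
  -- gradient a multiple of `t`. The outer radius `r ^ 2` places the support in the ball of radius
  -- `r`.
  let b : ContDiffBump (0 : ℝ) := ⟨r ^ 2 / 2, r ^ 2, by positivity, by linarith [pow_pos hr 2]⟩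
  let p : EuclideanSpace ℝ ι → ℝ := fun t => b (‖t‖ ^ 2)
  have hp : ContDiff ℝ ∞ p := b.contDiff.comp (contDiff_norm_sq ℝ)
  have hsupp : tsupport p ⊆ closedBall 0 r := by
    refine closure_minimal (fun t ht => ?_) isClosed_closedBall
    have h1 : ‖t‖ ^ 2 ∈ Function.support b := ht
    rw [b.support_eq, mem_ball_zero_iff, Real.norm_of_nonneg (by positivity)] at h1
    rw [mem_closedBall_zero_iff]
    exact (lt_of_pow_lt_pow_left₀ 2 hr.le h1).le
  have hcs : HasCompactSupport p := (isCompact_closedBall 0 r).of_isClosed_subset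
    (isClosed_tsupport p) hsupp
  have hpos : 0 < ∫ t, p t := by
    refine hp.continuous.integral_pos_of_hasCompactSupport_nonneg_nonzero hcs
      (fun t => b.nonneg) (x := 0) ?_
    have : b 0 = 1 := b.one_of_mem_closedBall (mem_closedBall_self b.rIn_pos.le)
    simp [p, this]
  have hder : ∀ t, HasFDerivAt p ((2 * deriv b (‖t‖ ^ 2)) • innerSL ℝ t) t := by
    intro t
    have h1 : HasDerivAt b (deriv b (‖t‖ ^ 2)) (‖t‖ ^ 2) :=
      (b.contDiff (n := 1)).differentiable (by simp) _ |>.hasDerivAt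
    have h2 := h1.comp_hasFDerivAt t (hasStrictFDerivAt_norm_sq t).hasFDerivAt
    have h3 : (2 * deriv b (‖t‖ ^ 2)) • innerSL ℝ t = deriv b (‖t‖ ^ 2) • 2 • innerSL ℝ t := by
      ext v
      simp
      ring
    rw [h3]
    exact h2
  refine ⟨(∫ t, p t)⁻¹ • p, fun t => (∫ t, p t)⁻¹ * (2 * deriv b (‖t‖ ^ 2)),
    contDiff_const.smul hp, (closure_mono (Function.support_const_smul_subset _ _)).trans hsupp,
    ?_, fun t => ?_⟩
  · simp only [Pi.smul_apply]
    rw [integral_smul, smul_eq_mul, inv_mul_cancel₀ hpos.ne']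
  · rw [mul_smul]
    exact (hder t).const_smul _

variable {V : Type*} [NormedAddCommGroup V] [NormedSpace ℝ V]

/-- For radial `φ` the moments `∫ φ(t) tᵢ ∂ⱼH(t) dt` are symmetric in `i` and `j`. -/
theorem radial_moment_symm {φ a : EuclideanSpace ℝ ι → ℝ} (hφ : ContDiff ℝ ∞ φ)
    (hc : HasCompactSupport φ) (ha : ∀ t, HasFDerivAt φ (a t • innerSL ℝ t) t)
    {H : EuclideanSpace ℝ ι → V} (hH : ContDiff ℝ 1 H) (i j : ι) :
    ∫ t, (φ t * t i) • fderiv ℝ H t (EuclideanSpace.single j 1) =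
      ∫ t, (φ t * t j) • fderiv ℝ H t (EuclideanSpace.single i 1) := by
  have hfd : ∀ (i : ι) t, HasFDerivAt (fun t : EuclideanSpace ℝ ι => φ t * t i)
      (φ t • (EuclideanSpace.proj i : EuclideanSpace ℝ ι →L[ℝ] ℝ) + t i • (a t • innerSL ℝ t)) t :=
    fun i t => (ha t).mul (EuclideanSpace.proj i : EuclideanSpace ℝ ι →L[ℝ] ℝ).hasFDerivAt
  have hcd : ∀ i : ι, ContDiff ℝ ∞ (fun t : EuclideanSpace ℝ ι => φ t * t i) := fun i =>
    hφ.mul (EuclideanSpace.proj i : EuclideanSpace ℝ ι →L[ℝ] ℝ).contDiff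
  have hcs : ∀ i : ι, HasCompactSupport (fun t : EuclideanSpace ℝ ι => φ t * t i) := fun i =>
    hc.mul_right
  have hval : ∀ i j : ι, ∀ t, fderiv ℝ (fun t : EuclideanSpace ℝ ι => φ t * t i) t
      (EuclideanSpace.single j 1) = (if i = j then φ t else 0) + a t * t i * t j := by
    intro i j t
    rw [(hfd i t).fderiv]
    simp [EuclideanSpace.inner_single_right]
    ring
  -- Integration by parts moves `∂ⱼ` onto `φ tᵢ`. Since `∂ⱼφ = a tⱼ`, the result `δᵢⱼ φ + a tᵢ tⱼ`
  -- is symmetric.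
  have key : ∀ i j : ι, ∫ t, (φ t * t i) • fderiv ℝ H t (EuclideanSpace.single j 1) =
      - ∫ t, ((if i = j then φ t else 0) + a t * t i * t j) • H t := by
    intro i j
    rw [integral_smul_fderiv_eq_neg_fderiv_smul_of_integrable]
    · simp_rw [hval]
    · refine Continuous.integrable_of_hasCompactSupport ?_ ?_
      · exact (((hcd i).continuous_fderiv (by simp)).clm_apply continuous_const).smul
          hH.continuous
      · exact ((hcs i).fderiv_apply ℝ _).smul_right
    · refine Continuous.integrable_of_hasCompactSupport ?_ ?_
      · exact (hcd i).continuous.smul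
          ((hH.continuous_fderiv (by simp)).clm_apply continuous_const)
      · exact (hcs i).smul_right
    · exact ((hcd i).continuous.smul hH.continuous).integrable_of_hasCompactSupport
        (hcs i).smul_right
    · exact fun t _ => (hcd i).differentiable (by simp) t
    · exact fun t _ => hH.differentiable (by simp) t
  rw [key, key]
  congr 2
  ext t
  simp only [eq_comm (a := i) (b := j)]
  congr 2
  ring

theorem clm_apply_eq_sum_single (T : EuclideanSpace ℝ ι →L[ℝ] V) (t : EuclideanSpace ℝ ι) :
    T t = ∑ i, t i • T (EuclideanSpace.single i 1) := by
  conv_lhs => rw [← (EuclideanSpace.basisFun ι ℝ).sum_repr t]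
  simp

variable [CompleteSpace V]

/-- The integral is the trace of the moment matrix `J i j = ∫ φ tᵢ ∂ⱼH`. The equation kills `∑ⱼ βⱼ
(J i j)` for each `i`; applying `αᵢ`, summing and symmetrising by `J i j = J j i` leaves twice the
trace. -/
theorem integral_radial_smul_fderiv_self {φ a : EuclideanSpace ℝ ι → ℝ} (hφ : ContDiff ℝ ∞ φ)
    (hc : HasCompactSupport φ) (ha : ∀ t, HasFDerivAt φ (a t • innerSL ℝ t) t)
    {α β : ι → V →L[ℝ] V}
    (hαβ : ∀ i j, α i * β j + α j * β i = if i = j then 2 else 0)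
    {H : EuclideanSpace ℝ ι → V} (hH : ContDiff ℝ 1 H)
    (hD : ∀ t, φ t ≠ 0 → ∑ i, β i (fderiv ℝ H t (EuclideanSpace.single i 1)) = 0) :
    ∫ t, φ t • fderiv ℝ H t t = 0 := by
  set J : ι → ι → V := fun i j => ∫ t, (φ t * t i) • fderiv ℝ H t (EuclideanSpace.single j 1)
    with hJ
  have hsymm : ∀ i j, J i j = J j i := fun i j => radial_moment_symm hφ hc ha hH i j
  have hint : ∀ i j, Integrable
      (fun t : EuclideanSpace ℝ ι => (φ t * t i) • fderiv ℝ H t (EuclideanSpace.single j 1)) := by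
    intro i j
    refine Continuous.integrable_of_hasCompactSupport ?_ ?_
    · exact (hφ.continuous.mul (EuclideanSpace.proj i : EuclideanSpace ℝ ι →L[ℝ] ℝ).continuous).smul
        ((hH.continuous_fderiv (by simp)).clm_apply continuous_const)
    · exact HasCompactSupport.smul_right (HasCompactSupport.mul_right hc)
  have hzero : ∀ i, ∑ j, β j (J i j) = 0 := by
    intro i
    have h1 : ∀ j, β j (J i j) =
        ∫ t, β j ((φ t * t i) • fderiv ℝ H t (EuclideanSpace.single j 1)) := fun j =>
      ((β j).integral_comp_comm (hint i j)).symm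
    simp_rw [h1]
    rw [← integral_finsetSum _ fun j _ => (β j).integrable_comp (hint i j)]
    refine integral_eq_zero_of_ae (Eventually.of_forall fun t => ?_)
    simp only [map_smul, ← Finset.smul_sum, Pi.zero_apply]
    by_cases ht : φ t = 0
    · simp [ht]
    · rw [hD t ht, smul_zero]
  have h2 : (2 : ℝ) • ∑ i, J i i = 0 := by
    have e1 : ∑ i, ∑ j, (α i * β j) (J i j) = 0 := by
      refine Finset.sum_eq_zero fun i _ => ?_
      simp only [mul_apply_eq_comp, ← map_sum, hzero, map_zero]
    have e2 : ∑ i, ∑ j, (α j * β i) (J i j) = 0 := by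
      rw [Finset.sum_comm, ← e1]
      exact Finset.sum_congr rfl fun i _ => Finset.sum_congr rfl fun j _ => by rw [hsymm]
    have e3 : ∑ i, ∑ j, (α i * β j + α j * β i) (J i j) = 0 := by
      simp only [add_apply, Finset.sum_add_distrib, e1, e2, add_zero]
    rw [← e3, Finset.smul_sum]
    refine Finset.sum_congr rfl fun i _ => ?_
    rw [Finset.sum_eq_single i]
    · rw [hαβ, if_pos rfl, two_smul, ← one_add_one_eq_two, add_apply,
        one_apply_eq_self]
    · intro j _ hj
      rw [hαβ, if_neg (Ne.symm hj), zero_apply]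
    · simp
  have h3 : ∑ i, J i i = 0 := (smul_eq_zero.1 h2).resolve_left two_ne_zero
  rw [← h3, ← integral_finsetSum _ fun j _ => hint j j]
  congr 1
  ext t
  rw [clm_apply_eq_sum_single (fderiv ℝ H t) t, Finset.smul_sum]
  simp only [mul_smul]

/-- The mean value property for compactly supported functions that solve the equation near `y`. -/
theorem integral_radial_smul_sub_eq {φ a : EuclideanSpace ℝ ι → ℝ} {r : ℝ} (hφ : ContDiff ℝ ∞ φ)
    (hφr : tsupport φ ⊆ closedBall 0 r) (hφ1 : ∫ t, φ t = 1)
    (ha : ∀ t, HasFDerivAt φ (a t • innerSL ℝ t) t)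
    {α β : ι → V →L[ℝ] V}
    (hαβ : ∀ i j, α i * β j + α j * β i = if i = j then 2 else 0)
    {G : EuclideanSpace ℝ ι → V} (hG : ContDiff ℝ 1 G) (hGc : HasCompactSupport G)
    {y : EuclideanSpace ℝ ι}
    (hD : ∀ x ∈ closedBall y r, ∑ i, β i (fderiv ℝ G x (EuclideanSpace.single i 1)) = 0) :
    ∫ t, φ t • G (y - t) = G y := by
  have hc : HasCompactSupport φ := (isCompact_closedBall 0 r).of_isClosed_subset
    (isClosed_tsupport φ) hφr
  have hG' : Continuous (fderiv ℝ G) := hG.continuous_fderiv (by simp)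
  obtain ⟨C, hC⟩ := hG'.bounded_above_of_compact_support (hGc.fderiv ℝ)
  -- Dilation joins `G y` at `s = 0` (as `φ` has mass one) to the weighted mean at `s = 1`; it
  -- remains to see that `I` is constant.
  let I : ℝ → V := fun s => ∫ t, φ t • G (y - s • t)
  have hI : ∀ s, HasDerivAt I (∫ t, φ t • -(fderiv ℝ G (y - s • t) t)) s := by
    intro s
    refine (hasDerivAt_integral_of_dominated_loc_of_deriv_le (s := univ)
      (F := fun s t => φ t • G (y - s • t)) (F' := fun s t => φ t • -(fderiv ℝ G (y - s • t) t))
      (bound := fun t => |φ t| * (C * ‖t‖)) univ_mem ?_ ?_ ?_ ?_ ?_ ?_).2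
    · refine Eventually.of_forall fun s => Continuous.aestronglyMeasurable ?_
      exact hφ.continuous.smul (hG.continuous.comp (by fun_prop))
    · exact (hφ.continuous.smul (hG.continuous.comp (by fun_prop))).integrable_of_hasCompactSupport
        hc.smul_right
    · refine Continuous.aestronglyMeasurable ?_
      exact hφ.continuous.smul ((hG'.comp (by fun_prop)).clm_apply continuous_id).neg
    · refine Eventually.of_forall fun t s _ => ?_
      rw [norm_smul, norm_neg, Real.norm_eq_abs]
      gcongr
      exact (fderiv ℝ G (y - s • t)).le_of_opNorm_le (hC _) t
    · refine Continuous.integrable_of_hasCompactSupport (by have := hφ.continuous; fun_prop) ?_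
      exact HasCompactSupport.mul_right (hc.norm)
    · refine Eventually.of_forall fun t s _ => HasDerivAt.const_smul _ ?_
      have h1 : HasDerivAt (fun s : ℝ => y - s • t) (-t) s := by
        simpa using ((hasDerivAt_id s).smul_const t).const_sub y
      have h2 := (hG.differentiable (by simp) (y - s • t)).hasFDerivAt.comp_hasDerivAt s h1
      rwa [map_neg] at h2
  have hI0 : ∀ s ∈ Icc (0 : ℝ) 1, ∫ t, φ t • -(fderiv ℝ G (y - s • t) t) = 0 := by
    intro s hs
    have hmem : ∀ t, φ t ≠ 0 → y - s • t ∈ closedBall y r := by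
      intro t ht
      have h1 : ‖t‖ ≤ r := mem_closedBall_zero_iff.1 (hφr (subset_tsupport _ ht))
      rw [mem_closedBall, dist_eq_norm, sub_sub_cancel_left, norm_neg, norm_smul,
        Real.norm_of_nonneg hs.1]
      nlinarith [hs.1, hs.2, norm_nonneg t]
    -- A function whose derivative at `t` is that of `G` at `y - s • t`: a rescaling of `G` if `s ≠
    -- 0`, and the linear map `fderiv ℝ G y` if `s = 0`.
    obtain ⟨H, hH, hH'⟩ : ∃ H : EuclideanSpace ℝ ι → V, ContDiff ℝ 1 H ∧
        ∀ t, fderiv ℝ H t = fderiv ℝ G (y - s • t) := by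
      by_cases h0 : s = 0
      · exact ⟨fderiv ℝ G y, (fderiv ℝ G y).contDiff, fun t => by simp [h0]⟩
      · refine ⟨fun t => (-s)⁻¹ • G (y - s • t), ?_, fun t => ?_⟩
        · exact contDiff_const.smul (hG.comp (by fun_prop))
        · have h1 : HasFDerivAt (fun t : EuclideanSpace ℝ ι => y - s • t)
              (-(s • ContinuousLinearMap.id ℝ (EuclideanSpace ℝ ι))) t := by
            simpa using ((hasFDerivAt_id t).const_smul s).const_sub y
          have h2 := ((hG.differentiable (by simp) (y - s • t)).hasFDerivAt.comp t h1).const_smul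
            (-s)⁻¹
          refine h2.fderiv.trans ?_
          ext v
          simp [inv_smul_smul₀ h0]
    have h3 := integral_radial_smul_fderiv_self hφ hc ha hαβ hH fun t ht => by
      rw [hH']
      exact hD _ (hmem t ht)
    simp_rw [hH'] at h3
    simp_rw [smul_neg]
    rw [integral_neg, h3, neg_zero]
  have hconst : I 1 = I 0 := constant_of_has_deriv_right_zero (a := 0) (b := 1)
    (fun s _ => (hI s).continuousAt.continuousWithinAt)
    (fun s hs => by
      have := (hI s).hasDerivWithinAt (s := Ici s)
      rwa [hI0 s ⟨hs.1, hs.2.le⟩] at this) 1 (by simp)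
  have h1 : I 1 = ∫ t, φ t • G (y - t) := by simp [I]
  rw [← h1, hconst]
  simp only [I, zero_smul, sub_zero]
  rw [integral_smul_const, hφ1, one_smul]

end

/-! ### Integrating factor and reproducing kernel -/

section


variable {ι : Type*} [Fintype ι]
variable {V : Type*} [NormedAddCommGroup V] [NormedSpace ℝ V]

variable [CompleteSpace V]

theorem hasFDerivAt_exp_coord_smul (M : V →L[ℝ] V) (o : ι) (y x : EuclideanSpace ℝ ι) :
    HasFDerivAt (fun x : EuclideanSpace ℝ ι => NormedSpace.exp ((y o - x o) • M))
      ((-(EuclideanSpace.proj o : EuclideanSpace ℝ ι →L[ℝ] ℝ)).smulRight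
        (NormedSpace.exp ((y o - x o) • M) * M)) x := by
  have h1 : HasFDerivAt (fun x : EuclideanSpace ℝ ι => y o - x o)
      (-(EuclideanSpace.proj o : EuclideanSpace ℝ ι →L[ℝ] ℝ)) x :=
    (EuclideanSpace.proj o : EuclideanSpace ℝ ι →L[ℝ] ℝ).hasFDerivAt.const_sub _
  exact (hasDerivAt_exp_smul_const M (y o - x o)).hasFDerivAt.comp x h1

theorem contDiff_exp_clm {m : WithTop ℕ∞} :
    ContDiff ℝ m (NormedSpace.exp : (V →L[ℝ] V) → (V →L[ℝ] V)) := by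
  have : AnalyticOnNhd ℝ (NormedSpace.exp : (V →L[ℝ] V) → (V →L[ℝ] V)) univ :=
    fun x _ => NormedSpace.exp_analytic x
  exact this.contDiff

variable [DecidableEq ι]

/-- `C¹` solutions on `Ω` of the first order system `∑ᵢ βᵢ ∂ᵢf = M f`. -/
def IsSystemSolution (β : ι → V →L[ℝ] V) (M : V →L[ℝ] V) (Ω : Set (EuclideanSpace ℝ ι))
    (f : EuclideanSpace ℝ ι → V) : Prop :=
  ContDiffOn ℝ 1 f Ω ∧
    ∀ y ∈ Ω, ∑ i, β i (fderiv ℝ f y (EuclideanSpace.single i 1)) = M (f y)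

/-- The mean value property at `y` for `exp ((y o - x o) • M) (f x)`, which satisfies the equation
without `M`. Centring the exponent at `y` makes the factor `1` at `y` and `exp (t o • M)` at `y -
t`. -/
theorem IsSystemSolution.eq_integral {φ a : EuclideanSpace ℝ ι → ℝ} {r R : ℝ}
    (hφ : ContDiff ℝ ∞ φ) (hφr : tsupport φ ⊆ closedBall 0 r) (hφ1 : ∫ t, φ t = 1)
    (ha : ∀ t, HasFDerivAt φ (a t • innerSL ℝ t) t) (hr : 0 < r) (hrR : r < R)
    {α β : ι → V →L[ℝ] V} {M : V →L[ℝ] V} {o : ι}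
    (hαβ : ∀ i j, α i * β j + α j * β i = if i = j then 2 else 0) (hβo : β o = 1)
    (hM : ∀ i, Commute (β i) M) {Ω : Set (EuclideanSpace ℝ ι)} (hΩ : IsOpen Ω)
    {f : EuclideanSpace ℝ ι → V} (hf : IsSystemSolution β M Ω f)
    {y : EuclideanSpace ℝ ι} (hy : closedBall y R ⊆ Ω) :
    f y = ∫ t, (φ t • NormedSpace.exp (t o • M)) (f (y - t)) := by
  -- The cutoff makes `G` globally `C¹` with support in `closedBall y R`, without changing it near
  -- `closedBall y r`.
  let χ : ContDiffBump y := ⟨(r + R) / 2, R, by linarith, by linarith⟩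
  let w : EuclideanSpace ℝ ι → V →L[ℝ] V := fun x => NormedSpace.exp ((y o - x o) • M)
  let u : EuclideanSpace ℝ ι → V := fun x => w x (f x)
  have hw : ContDiff ℝ 1 w := contDiff_exp_clm.comp
    ((contDiff_const.sub (EuclideanSpace.proj o : EuclideanSpace ℝ ι →L[ℝ] ℝ).contDiff).smul
      contDiff_const)
  have hu : ContDiffOn ℝ 1 u Ω := hw.contDiffOn.clm_apply hf.1
  let G : EuclideanSpace ℝ ι → V := fun x => χ x • u x
  have hG : ContDiff ℝ 1 G := by
    rw [contDiff_iff_contDiffAt]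
    intro x
    by_cases hx : x ∈ Ω
    · exact χ.contDiff.contDiffAt.smul (hu.contDiffAt (hΩ.mem_nhds hx))
    · have hx' : x ∉ tsupport χ := fun h => hx (hy (χ.tsupport_eq ▸ h))
      refine contDiffAt_const (c := (0 : V)) |>.congr_of_eventuallyEq ?_
      filter_upwards [notMem_tsupport_iff_eventuallyEq.1 hx'] with z hz
      simp only [G, hz, Pi.zero_apply, zero_smul]
  have hGc : HasCompactSupport G := χ.hasCompactSupport.smul_right
  have hGu : ∀ x ∈ ball y ((r + R) / 2), G x = u x := by
    intro x hx
    simp only [G]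
    rw [χ.one_of_mem_closedBall (ball_subset_closedBall hx), one_smul]
  have hsub : closedBall y r ⊆ ball y ((r + R) / 2) := closedBall_subset_ball (by linarith)
  have hD : ∀ x ∈ closedBall y r,
      ∑ i, β i (fderiv ℝ G x (EuclideanSpace.single i 1)) = 0 := by
    intro x hx
    have hxΩ : x ∈ Ω := hy (closedBall_subset_closedBall hrR.le hx)
    have hev : G =ᶠ[𝓝 x] u := by
      filter_upwards [isOpen_ball.mem_nhds (hsub hx)] with z hz using hGu z hz
    have hfd : HasFDerivAt f (fderiv ℝ f x) x :=
      ((hf.1.contDiffAt (hΩ.mem_nhds hxΩ)).differentiableAt (by simp)).hasFDerivAt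
    have hder := (hasFDerivAt_exp_coord_smul M o y x).clm_apply hfd
    rw [hev.fderiv_eq, hder.fderiv]
    have hcomm : ∀ i v, β i (w x v) = w x (β i v) := by
      intro i v
      have := ((hM i).smul_right (y o - x o)).exp_right
      exact congrArg (fun T : V →L[ℝ] V => T v) this.eq
    -- The factor varies only in direction `o`, where `β o = 1`, so its derivative contributes
    -- exactly `-w x (M (f x))`.
    have hterm : ∀ i, β i (((w x).comp (fderiv ℝ f x) +
        ContinuousLinearMap.flip ((-(EuclideanSpace.proj o : EuclideanSpace ℝ ι →L[ℝ] ℝ)).smulRight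
          (w x * M)) (f x)) (EuclideanSpace.single i 1)) =
        w x (β i (fderiv ℝ f x (EuclideanSpace.single i 1))) -
          (if o = i then w x (M (f x)) else 0) := by
      intro i
      by_cases hi : o = i
      · subst hi
        simp [hβo, sub_eq_add_neg]
      · simp [hi, hcomm]
    refine (Finset.sum_congr rfl fun i _ => hterm i).trans ?_
    rw [Finset.sum_sub_distrib, ← map_sum, hf.2 x hxΩ]
    simp
  have hmean := integral_radial_smul_sub_eq hφ hφr hφ1 ha hαβ hG hGc hD
  have hGy : G y = f y := by
    rw [hGu y (mem_ball_self (by linarith))]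
    simp [u, w]
  rw [← hGy, ← hmean]
  congr 1
  ext t
  by_cases ht : φ t = 0
  · simp [ht]
  · have h1 : y - t ∈ ball y ((r + R) / 2) := hsub (by
      have := hφr (subset_tsupport _ ht)
      simpa [mem_closedBall, dist_eq_norm] using this)
    rw [hGu _ h1]
    simp [u, w]

/-- Solutions are reproduced by a smooth compactly supported kernel. -/
theorem exists_reproducing_kernel {α β : ι → V →L[ℝ] V} {M : V →L[ℝ] V} {o : ι}
    (hαβ : ∀ i j, α i * β j + α j * β i = if i = j then 2 else 0) (hβo : β o = 1)
    (hM : ∀ i, Commute (β i) M) {Ω : Set (EuclideanSpace ℝ ι)} (hΩ : IsOpen Ω) {r R : ℝ}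
    (hr : 0 < r) (hrR : r < R) :
    ∃ K : EuclideanSpace ℝ ι → V →L[ℝ] V, ContDiff ℝ ∞ K ∧ tsupport K ⊆ closedBall 0 r ∧
      ∀ f, IsSystemSolution β M Ω f → ∀ y, closedBall y R ⊆ Ω →
        f y = ∫ t, K t (f (y - t)) := by
  obtain ⟨φ, a, hφ, hφr, hφ1, ha⟩ := exists_radial_mollifier ι hr
  refine ⟨fun t => φ t • NormedSpace.exp (t o • M), ?_, ?_, fun f hf y hy =>
    hf.eq_integral hφ hφr hφ1 ha hr hrR hαβ hβo hM hΩ hy⟩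
  · exact hφ.smul (contDiff_exp_clm.comp
      ((EuclideanSpace.proj o : EuclideanSpace ℝ ι →L[ℝ] ℝ).contDiff.smul contDiff_const))
  · exact (closure_mono (Function.support_smul_subset_left _ _)).trans hφr

/-! ### Uniform convergence of convolutions -/

variable {E F G W : Type*} [NormedAddCommGroup E] [NormedSpace ℝ E] [NormedAddCommGroup F]
  [NormedSpace ℝ F] [NormedAddCommGroup W] [NormedSpace ℝ W] [NormedAddCommGroup G]
  [MeasurableSpace G] [BorelSpace G]

theorem tendstoUniformly_convolution {μ : Measure G} [μ.IsAddLeftInvariant] [μ.IsNegInvariant]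
    [IsFiniteMeasureOnCompacts μ] [SecondCountableTopology G]
    (L : E →L[ℝ] F →L[ℝ] W) {K : G → E} (hK : Continuous K) (hc : HasCompactSupport K)
    {u : ℕ → G → F} {v : G → F} (hu : ∀ k, LocallyIntegrable (u k) μ)
    (hv : LocallyIntegrable v μ) (huv : TendstoUniformly u v atTop) :
    TendstoUniformly (fun k => K ⋆[L, μ] u k) (K ⋆[L, μ] v) atTop := by
  rw [Metric.tendstoUniformly_iff] at huv ⊢
  intro ε hε
  -- Convolution with `K` enlarges the sup norm by at most the factor `C`. Dividing by `C + 1` below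
  -- covers `C = 0`.
  set C := ‖L‖ * ∫ t, ‖K t‖ ∂μ with hC
  have hC0 : 0 ≤ C := mul_nonneg (norm_nonneg L) (integral_nonneg fun _ => norm_nonneg _)
  have hKi : Integrable (fun t => ‖K t‖) μ := hK.norm.integrable_of_hasCompactSupport hc.norm
  filter_upwards [huv (ε / (C + 1)) (by positivity)] with k hk x
  have h1 := hc.convolutionExists_left L hK hv x
  have h2 := hc.convolutionExists_left L hK (hu k) x
  rw [dist_eq_norm, convolution_def, convolution_def, ← integral_sub h1 h2]
  calc ‖∫ t, (L (K t) (v (x - t)) - L (K t) (u k (x - t))) ∂μ‖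
      ≤ ∫ t, ‖L‖ * ‖K t‖ * (ε / (C + 1)) ∂μ := by
        refine norm_integral_le_of_norm_le ((hKi.const_mul _).mul_const _)
          (Eventually.of_forall fun t => ?_)
        rw [← map_sub]
        refine (L.le_opNorm₂ _ _).trans ?_
        gcongr
        rw [← dist_eq_norm]
        exact (hk _).le
    _ = C * (ε / (C + 1)) := by rw [integral_mul_const, integral_const_mul]
    _ < ε := by
        rw [mul_div_assoc', div_lt_iff₀ (by positivity)]
        nlinarith

/-- The derivative falls on `K`, so the functions `u k` and `v` need no differentiability. -/
theorem tendstoUniformly_fderiv_convolution [CompleteSpace W] [NormedSpace ℝ G]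
    [FiniteDimensional ℝ G] {μ : Measure G}
    [μ.IsAddLeftInvariant] [μ.IsNegInvariant] [IsFiniteMeasureOnCompacts μ]
    (L : E →L[ℝ] F →L[ℝ] W) {K : G → E} (hK : ContDiff ℝ 1 K) (hc : HasCompactSupport K)
    {u : ℕ → G → F} {v : G → F} (hu : ∀ k, LocallyIntegrable (u k) μ)
    (hv : LocallyIntegrable v μ) (huv : TendstoUniformly u v atTop) :
    TendstoUniformly (fun k => fderiv ℝ (K ⋆[L, μ] u k)) (fderiv ℝ (K ⋆[L, μ] v)) atTop := by
  have hfd : ∀ {w : G → F}, LocallyIntegrable w μ →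
      fderiv ℝ (K ⋆[L, μ] w) = fderiv ℝ K ⋆[L.precompL G, μ] w := fun hw =>
    funext fun x => (hc.hasFDerivAt_convolution_left L hK hw x).fderiv
  simp_rw [hfd hv, fun k => hfd (hu k)]
  have : ProperSpace G := FiniteDimensional.proper ℝ G
  exact tendstoUniformly_convolution (L.precompL G) (hK.continuous_fderiv (by simp))
    (hc.fderiv ℝ) hu hv huv

end

/-! ### Weierstrass' theorem for the general system -/

section


variable {ι : Type*} [Fintype ι] [DecidableEq ι]
variable {V : Type*} [NormedAddCommGroup V] [NormedSpace ℝ V] [CompleteSpace V]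
variable {α β : ι → V →L[ℝ] V} {M : V →L[ℝ] V} {o : ι} {Ω : Set (EuclideanSpace ℝ ι)}

theorem weierstrass_local
    (hαβ : ∀ i j, α i * β j + α j * β i = if i = j then 2 else 0) (hβo : β o = 1)
    (hM : ∀ i, Commute (β i) M) (hΩ : IsOpen Ω)
    {f : ℕ → EuclideanSpace ℝ ι → V} {g : EuclideanSpace ℝ ι → V}
    (hf : ∀ k, IsSystemSolution β M Ω (f k))
    (hfg : ∀ K ⊆ Ω, IsCompact K → TendstoUniformlyOn f g atTop K)
    {y : EuclideanSpace ℝ ι} (hy : y ∈ Ω) :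
    ∃ ρ > 0, ContDiffOn ℝ ∞ g (ball y ρ) ∧
      TendstoUniformlyOn (fun k => fderiv ℝ (f k)) (fderiv ℝ g) atTop (ball y ρ) := by
  obtain ⟨R, hR, hRΩ⟩ := nhds_basis_closedBall.mem_iff.1 (hΩ.mem_nhds hy)
  -- For `x` in `ball y ρ` the ball of radius `2 * ρ` about `x`, required by the kernel, lies in
  -- `closedBall y R`.
  set ρ := R / 3 with hρ
  have hρ0 : 0 < ρ := by positivity
  obtain ⟨K, hK, hKs, hrep⟩ := exists_reproducing_kernel hαβ hβo hM hΩ hρ0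
    (show ρ < 2 * ρ by linarith)
  have hKc : HasCompactSupport K := (isCompact_closedBall 0 ρ).of_isClosed_subset
    (isClosed_tsupport K) hKs
  have hcomp : IsCompact (closedBall y R) := isCompact_closedBall y R
  have hu := hfg _ hRΩ hcomp
  have hfc : ∀ k, ContinuousOn (f k) (closedBall y R) := fun k => (hf k).1.continuousOn.mono hRΩ
  have hgc : ContinuousOn g (closedBall y R) :=
    hu.continuousOn (Frequently.of_forall hfc)
  have hloc : ∀ h : EuclideanSpace ℝ ι → V, ContinuousOn h (closedBall y R) →
      LocallyIntegrable ((closedBall y R).indicator h) volume := fun h hh =>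
    ((hh.integrableOn_compact hcomp).integrable_indicator
      measurableSet_closedBall).locallyIntegrable
  -- Only values on `closedBall y R` enter the convolutions at points of `ball y ρ`. Truncating
  -- there gives integrable functions converging uniformly on the whole space.
  have hui : TendstoUniformly (fun k => (closedBall y R).indicator (f k))
      ((closedBall y R).indicator g) atTop := by
    rw [Metric.tendstoUniformlyOn_iff] at hu
    rw [Metric.tendstoUniformly_iff]
    intro ε hε
    filter_upwards [hu ε hε] with k hk x
    by_cases hx : x ∈ closedBall y R
    · simpa [indicator_of_mem hx] using hk x hx
    · simpa [indicator_of_notMem hx] using hε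
  let L : (V →L[ℝ] V) →L[ℝ] V →L[ℝ] V := ContinuousLinearMap.id ℝ (V →L[ℝ] V)
  have hfeq : ∀ k, EqOn (f k) (K ⋆[L, volume] (closedBall y R).indicator (f k)) (ball y ρ) := by
    intro k x hx
    have hx' : dist x y < ρ := hx
    rw [hrep _ (hf k) x ((closedBall_subset_closedBall' (by linarith)).trans hRΩ)]
    rw [convolution_def]
    congr 1
    ext t
    by_cases ht : K t = 0
    · simp [ht]
    · have h1 : ‖t‖ ≤ ρ := mem_closedBall_zero_iff.1 (hKs (subset_tsupport _ ht))
      have h2 : x - t ∈ closedBall y R := by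
        have h3 : dist (x - t) x = ‖t‖ := by simp
        have := dist_triangle (x - t) x y
        rw [mem_closedBall]
        linarith
      rw [indicator_of_mem h2]
      rfl
  have hsub : ball y ρ ⊆ closedBall y R :=
    (ball_subset_ball (by linarith)).trans ball_subset_closedBall
  have hgeq : EqOn g (K ⋆[L, volume] (closedBall y R).indicator g) (ball y ρ) := by
    intro x hx
    have h1 := (tendstoUniformly_convolution L hK.continuous hKc (fun k => hloc _ (hfc k))
      (hloc _ hgc) hui).tendsto_at x
    refine tendsto_nhds_unique (hu.tendsto_at (hsub hx)) (h1.congr fun k => ?_)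
    exact (hfeq k hx).symm
  have hfd : ∀ {u v : EuclideanSpace ℝ ι → V}, EqOn u v (ball y ρ) →
      EqOn (fderiv ℝ v) (fderiv ℝ u) (ball y ρ) := fun h x hx =>
    (h.eventuallyEq_of_mem (isOpen_ball.mem_nhds hx)).fderiv_eq.symm
  refine ⟨ρ, hρ0, ?_, ?_⟩
  · exact (hKc.contDiff_convolution_left L hK (hloc g hgc)).contDiffOn.congr hgeq
  · have hconv := tendstoUniformly_fderiv_convolution (μ := volume) L (hK.of_le (by simp)) hKc
      (fun k => hloc _ (hfc k)) (hloc _ hgc) hui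
    have h1 := (hconv.tendstoUniformlyOn (s := ball y ρ)).congr
      (Eventually.of_forall fun k => hfd (hfeq k))
    exact h1.congr_right (hfd hgeq)

theorem contDiffOn_of_tendsto
    (hαβ : ∀ i j, α i * β j + α j * β i = if i = j then 2 else 0) (hβo : β o = 1)
    (hM : ∀ i, Commute (β i) M) (hΩ : IsOpen Ω)
    {f : ℕ → EuclideanSpace ℝ ι → V} {g : EuclideanSpace ℝ ι → V}
    (hf : ∀ k, IsSystemSolution β M Ω (f k))
    (hfg : ∀ K ⊆ Ω, IsCompact K → TendstoUniformlyOn f g atTop K) : ContDiffOn ℝ ∞ g Ω := by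
  intro y hy
  obtain ⟨ρ, hρ, hg, -⟩ := weierstrass_local hαβ hβo hM hΩ hf hfg hy
  exact (hg.contDiffAt (ball_mem_nhds y hρ)).contDiffWithinAt

theorem tendstoUniformlyOn_fderiv
    (hαβ : ∀ i j, α i * β j + α j * β i = if i = j then 2 else 0) (hβo : β o = 1)
    (hM : ∀ i, Commute (β i) M) (hΩ : IsOpen Ω)
    {f : ℕ → EuclideanSpace ℝ ι → V} {g : EuclideanSpace ℝ ι → V}
    (hf : ∀ k, IsSystemSolution β M Ω (f k))
    (hfg : ∀ K ⊆ Ω, IsCompact K → TendstoUniformlyOn f g atTop K) :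
    ∀ K ⊆ Ω, IsCompact K →
      TendstoUniformlyOn (fun k => fderiv ℝ (f k)) (fderiv ℝ g) atTop K := by
  rw [← tendstoLocallyUniformlyOn_iff_forall_isCompact hΩ]
  intro s hs y hy
  obtain ⟨ρ, hρ, -, h⟩ := weierstrass_local hαβ hβo hM hΩ hf hfg hy
  exact ⟨ball y ρ, mem_nhdsWithin_of_mem_nhds (ball_mem_nhds y hρ), h s hs⟩

/-- Regularity is the constant-sequence case of the limit theorem. -/
theorem IsSystemSolution.contDiffOn
    (hαβ : ∀ i j, α i * β j + α j * β i = if i = j then 2 else 0) (hβo : β o = 1)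
    (hM : ∀ i, Commute (β i) M) (hΩ : IsOpen Ω) {f : EuclideanSpace ℝ ι → V}
    (hf : IsSystemSolution β M Ω f) : ContDiffOn ℝ ∞ f Ω :=
  contDiffOn_of_tendsto (f := fun _ => f) hαβ hβo hM hΩ (fun _ => hf)
    (fun _ _ _ _ hs => Eventually.of_forall fun _ _ _ => refl_mem_uniformity hs)

/-- Locally uniform limits of solutions are solutions. -/
theorem IsSystemSolution.of_tendsto
    (hαβ : ∀ i j, α i * β j + α j * β i = if i = j then 2 else 0) (hβo : β o = 1)
    (hM : ∀ i, Commute (β i) M) (hΩ : IsOpen Ω)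
    {f : ℕ → EuclideanSpace ℝ ι → V} {g : EuclideanSpace ℝ ι → V}
    (hf : ∀ k, IsSystemSolution β M Ω (f k))
    (hfg : ∀ K ⊆ Ω, IsCompact K → TendstoUniformlyOn f g atTop K) :
    IsSystemSolution β M Ω g := by
  refine ⟨(contDiffOn_of_tendsto hαβ hβo hM hΩ hf hfg).of_le (by simp), fun y hy => ?_⟩
  have hsing : ({y} : Set (EuclideanSpace ℝ ι)) ⊆ Ω := singleton_subset_iff.2 hy
  have h1 := (hfg _ hsing isCompact_singleton).tendsto_at rfl
  have h2 := (tendstoUniformlyOn_fderiv hαβ hβo hM hΩ hf hfg _ hsing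
    isCompact_singleton).tendsto_at rfl
  refine tendsto_nhds_unique (tendsto_finsetSum _ fun i _ =>
    ((β i).continuous.tendsto _).comp
      (((ContinuousLinearMap.apply ℝ V (EuclideanSpace.single i 1)).continuous.tendsto _).comp
        h2)) ?_
  refine ((M.continuous.tendsto _).comp h1).congr fun k => ?_
  exact ((hf k).2 y hy).symm

omit [CompleteSpace V] in
theorem IsSystemSolution.congr (hΩ : IsOpen Ω) {f g : EuclideanSpace ℝ ι → V}
    (hf : IsSystemSolution β M Ω f) (hfg : EqOn g f Ω) : IsSystemSolution β M Ω g := by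
  refine ⟨hf.1.congr hfg, fun y hy => ?_⟩
  rw [(hfg.eventuallyEq_of_mem (hΩ.mem_nhds hy)).fderiv_eq, hfg hy]
  exact hf.2 y hy

/-- Directional derivatives of solutions are solutions. -/
theorem IsSystemSolution.fderiv_apply
    (hαβ : ∀ i j, α i * β j + α j * β i = if i = j then 2 else 0) (hβo : β o = 1)
    (hM : ∀ i, Commute (β i) M) (hΩ : IsOpen Ω) {f : EuclideanSpace ℝ ι → V}
    (hf : IsSystemSolution β M Ω f) (v : EuclideanSpace ℝ ι) :
    IsSystemSolution β M Ω (fun y => fderiv ℝ f y v) := by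
  have hs := hf.contDiffOn hαβ hβo hM hΩ
  have hs' : ContDiffOn ℝ 1 (fderiv ℝ f) Ω := hs.fderiv_of_isOpen hΩ (by norm_cast)
  refine ⟨hs'.clm_apply contDiffOn_const, fun y hy => ?_⟩
  have hd : DifferentiableAt ℝ (fderiv ℝ f) y :=
    (hs'.contDiffAt (hΩ.mem_nhds hy)).differentiableAt (by simp)
  have hsym : IsSymmSndFDerivAt ℝ f y :=
    (hs.contDiffAt (hΩ.mem_nhds hy)).isSymmSndFDerivAt
      (by rw [minSmoothness_of_isRCLikeNormedField]; norm_cast)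
  have hap : ∀ v w : EuclideanSpace ℝ ι,
      fderiv ℝ (fun y => fderiv ℝ f y v) y w = fderiv ℝ (fderiv ℝ f) y w v := by
    intro v w
    rw [(hd.hasFDerivAt.clm_apply (hasFDerivAt_const v y)).fderiv]
    simp
  have hfd : HasFDerivAt f (fderiv ℝ f y) y :=
    ((hf.1.contDiffAt (hΩ.mem_nhds hy)).differentiableAt (by simp)).hasFDerivAt
  have h1 : HasFDerivAt
      (fun x => ∑ i, β i (fderiv ℝ f x (EuclideanSpace.single i 1)))
      (∑ i, (β i).comp (fderiv ℝ (fun x => fderiv ℝ f x (EuclideanSpace.single i 1)) y)) y := by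
    refine HasFDerivAt.fun_sum fun i _ => (β i).hasFDerivAt.comp y ?_
    exact (hd.clm_apply (differentiableAt_const _)).hasFDerivAt
  -- Both sides of the equation are differentiated at `y`. Comparison in direction `v`, with
  -- symmetry of the second derivative, gives the equation for `∂ᵥ f`.
  have h2 : HasFDerivAt (fun x => ∑ i, β i (fderiv ℝ f x (EuclideanSpace.single i 1)))
      (M.comp (fderiv ℝ f y)) y := by
    refine (M.hasFDerivAt.comp y hfd).congr_of_eventuallyEq ?_
    filter_upwards [hΩ.mem_nhds hy] with x hx using hf.2 x hx
  have h3 := congrArg (fun T : EuclideanSpace ℝ ι →L[ℝ] V => T v) (h1.unique h2)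
  simp only [sum_apply, ContinuousLinearMap.comp_apply, hap] at h3
  rw [← h3]
  refine Finset.sum_congr rfl fun i _ => ?_
  rw [hap, hsym.eq]

end

/-! ### The Clifford system and multi-indices -/

section


instance instFiniteDimensionalCl (n : ℕ) : FiniteDimensional ℝ (Cl n) :=
  (clBasis n).finiteDimensional_of_finite

/-- Left multiplication by a Clifford number. -/
noncomputable def leftMul {n : ℕ} (a : Cl n) : Cl n →L[ℝ] Cl n :=
  LinearMap.toContinuousLinearMap (LinearMap.mulLeft ℝ a)

theorem leftMul_apply {n : ℕ} (a b : Cl n) : leftMul a b = a * b := rfl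

/-- The coefficients `1, s e₁, …, s eₙ`. -/
noncomputable def diracCoeff {n : ℕ} (s : ℝ) (i : Fin (n + 1)) : Cl n :=
  Fin.cases 1 (fun j => s • e j) i

/-- The terms mixing `1` with a generator cancel by the opposite signs; two generators give `-(eᵢ eⱼ
+ eⱼ eᵢ) = 2δᵢⱼ`. -/
theorem diracCoeff_relations {n : ℕ} (i j : Fin (n + 1)) :
    (diracCoeff 1 i * diracCoeff (-1) j + diracCoeff 1 j * diracCoeff (-1) i : Cl n) =
      if i = j then 2 else 0 := by
  induction i using Fin.cases with
  | zero =>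
    induction j using Fin.cases with
    | zero => simp [diracCoeff, one_add_one_eq_two]
    | succ j => simp [diracCoeff, (Fin.succ_ne_zero j).symm]
  | succ i =>
    induction j using Fin.cases with
    | zero => simp [diracCoeff]
    | succ j =>
      have h : (e i * e j + e j * e i : Cl n) = if i = j then -2 else 0 := by
        rw [e_anticomm]
        split_ifs
        · rw [map_neg]
          exact congrArg Neg.neg (map_ofNat (algebraMap ℝ (Cl n)) 2)
        · exact map_zero _
      have h2 : (-(e i * e j) + -(e j * e i) : Cl n) = -(e i * e j + e j * e i) := by abel
      simp only [diracCoeff, Fin.cases_succ, one_smul, neg_smul, mul_neg, Fin.succ_inj]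
      rw [h2, h]
      split_ifs <;> simp

theorem leftMul_diracCoeff_relations {n : ℕ} (i j : Fin (n + 1)) :
    leftMul (diracCoeff 1 i : Cl n) * leftMul (diracCoeff (-1) j) +
      leftMul (diracCoeff 1 j) * leftMul (diracCoeff (-1) i) = if i = j then 2 else 0 := by
  ext a
  change diracCoeff 1 i * (diracCoeff (-1) j * a) + diracCoeff 1 j * (diracCoeff (-1) i * a) = _
  rw [← mul_assoc, ← mul_assoc, ← add_mul, diracCoeff_relations]
  split_ifs
  · rw [two_mul, ← one_add_one_eq_two, add_apply, one_apply_eq_self]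
  · rw [zero_mul, zero_apply]

theorem leftMul_diracCoeff_zero {n : ℕ} (s : ℝ) : leftMul (diracCoeff s 0 : Cl n) = 1 := by
  ext a
  simp [leftMul_apply, diracCoeff]

theorem commute_leftMul_diracCoeff {n : ℕ} {M : Cl n →L[ℝ] Cl n}
    (hM : ∀ (j : Fin n) (a : Cl n), M (e j * a) = e j * M a) (s : ℝ) (i : Fin (n + 1)) :
    Commute (leftMul (diracCoeff s i)) M := by
  ext a
  change diracCoeff s i * M a = M (diracCoeff s i * a)
  induction i using Fin.cases with
  | zero => simp [diracCoeff]
  | succ j => simp [diracCoeff, hM]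

variable {n : ℕ} {M : Cl n →L[ℝ] Cl n} {Ω : Set (EuclideanSpace ℝ (Fin (n + 1)))}

theorem partialDeriv_eq_fderiv {f : EuclideanSpace ℝ (Fin (n + 1)) → Cl n}
    {y : EuclideanSpace ℝ (Fin (n + 1))} (hf : DifferentiableAt ℝ f y) (i : Fin (n + 1)) :
    partialDeriv i f y = fderiv ℝ f y (EuclideanSpace.single i 1) :=
  hf.lineDeriv_eq_fderiv

theorem mem_solutionSpace_iff (hΩ : IsOpen Ω) (f : EuclideanSpace ℝ (Fin (n + 1)) → Cl n) :
    f ∈ solutionSpace M Ω ↔ IsSystemSolution (fun i => leftMul (diracCoeff (-1) i)) M Ω f := by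
  refine and_congr_right fun hf => forall₂_congr fun y hy => ?_
  have hd : DifferentiableAt ℝ f y :=
    (hf.contDiffAt (hΩ.mem_nhds hy)).differentiableAt (by simp)
  simp only [partialDeriv_eq_fderiv hd]
  rw [Fin.sum_univ_succ, leftMul_diracCoeff_zero, one_apply_eq_self]
  simp only [leftMul_apply, diracCoeff, Fin.cases_succ, neg_smul, one_smul, neg_mul,
    Finset.sum_neg_distrib]
  rw [← sub_eq_add_neg, sub_eq_iff_eq_add']

variable (hM : ∀ (j : Fin n) (a : Cl n), M (e j * a) = e j * M a) (hΩ : IsOpen Ω)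
include hM hΩ

theorem contDiffOn_of_mem_solutionSpace {f : EuclideanSpace ℝ (Fin (n + 1)) → Cl n}
    (hf : f ∈ solutionSpace M Ω) : ContDiffOn ℝ ∞ f Ω :=
  ((mem_solutionSpace_iff hΩ f).1 hf).contDiffOn leftMul_diracCoeff_relations
    (leftMul_diracCoeff_zero _) (commute_leftMul_diracCoeff hM _) hΩ

theorem mem_solutionSpace_of_tendsto {f : ℕ → EuclideanSpace ℝ (Fin (n + 1)) → Cl n}
    {g : EuclideanSpace ℝ (Fin (n + 1)) → Cl n} (hf : ∀ k, f k ∈ solutionSpace M Ω)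
    (hfg : ConvergesUniformlyOnCompacts f g Ω) : g ∈ solutionSpace M Ω :=
  (mem_solutionSpace_iff hΩ g).2 <| IsSystemSolution.of_tendsto leftMul_diracCoeff_relations
    (leftMul_diracCoeff_zero _) (commute_leftMul_diracCoeff hM _) hΩ
    (fun k => (mem_solutionSpace_iff hΩ _).1 (hf k)) hfg

theorem partialDeriv_mem_solutionSpace {f : EuclideanSpace ℝ (Fin (n + 1)) → Cl n}
    (hf : f ∈ solutionSpace M Ω) (i : Fin (n + 1)) : partialDeriv i f ∈ solutionSpace M Ω := by
  rw [mem_solutionSpace_iff hΩ]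
  refine (((mem_solutionSpace_iff hΩ f).1 hf).fderiv_apply leftMul_diracCoeff_relations
    (leftMul_diracCoeff_zero _) (commute_leftMul_diracCoeff hM _) hΩ
    (EuclideanSpace.single i 1)).congr hΩ fun y hy => ?_
  exact partialDeriv_eq_fderiv
    ((hf.1.contDiffAt (hΩ.mem_nhds hy)).differentiableAt (by simp)) i

theorem partialDeriv_convergesUniformlyOnCompacts
    {f : ℕ → EuclideanSpace ℝ (Fin (n + 1)) → Cl n}
    {g : EuclideanSpace ℝ (Fin (n + 1)) → Cl n} (hf : ∀ k, f k ∈ solutionSpace M Ω)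
    (hfg : ConvergesUniformlyOnCompacts f g Ω) (i : Fin (n + 1)) :
    ConvergesUniformlyOnCompacts (fun k => partialDeriv i (f k)) (partialDeriv i g) Ω := by
  intro K hK hKc
  have hg := mem_solutionSpace_of_tendsto hM hΩ hf hfg
  have h := tendstoUniformlyOn_fderiv leftMul_diracCoeff_relations
    (leftMul_diracCoeff_zero _) (commute_leftMul_diracCoeff hM _) hΩ
    (fun k => (mem_solutionSpace_iff hΩ _).1 (hf k)) hfg K hK hKc
  have h2 := (ContinuousLinearMap.apply ℝ (Cl n)
    (EuclideanSpace.single i (1 : ℝ))).uniformContinuous.comp_tendstoUniformlyOn h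
  have heq : ∀ u ∈ solutionSpace M Ω,
      EqOn (fun y => fderiv ℝ u y (EuclideanSpace.single i 1)) (partialDeriv i u) K :=
    fun u hu y hy => (partialDeriv_eq_fderiv
      ((hu.1.contDiffAt (hΩ.mem_nhds (hK hy))).differentiableAt (by simp)) i).symm
  exact (TendstoUniformlyOn.congr h2 (Eventually.of_forall fun k => heq _ (hf k))).congr_right
    (heq _ hg)

/-- Membership in the solution space is carried through the induction because each further
derivative converges only by applying the first-order result to solutions. -/
theorem foldr_partialDeriv_convergesUniformlyOnCompacts (β : Fin (n + 1) → ℕ)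
    {f : ℕ → EuclideanSpace ℝ (Fin (n + 1)) → Cl n}
    {g : EuclideanSpace ℝ (Fin (n + 1)) → Cl n} (hf : ∀ k, f k ∈ solutionSpace M Ω)
    (hfg : ConvergesUniformlyOnCompacts f g Ω) (l : List (Fin (n + 1))) :
    (∀ k, l.foldr (fun i u => (partialDeriv i)^[β i] u) (f k) ∈ solutionSpace M Ω) ∧
      ConvergesUniformlyOnCompacts (fun k => l.foldr (fun i u => (partialDeriv i)^[β i] u) (f k))
        (l.foldr (fun i u => (partialDeriv i)^[β i] u) g) Ω := by
  induction l with
  | nil => exact ⟨hf, hfg⟩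
  | cons i l ih =>
    simp only [List.foldr_cons]
    induction β i with
    | zero => exact ih
    | succ m ihm =>
      simp only [Function.iterate_succ_apply']
      exact ⟨fun k => partialDeriv_mem_solutionSpace hM hΩ (ihm.1 k) i,
        partialDeriv_convergesUniformlyOnCompacts hM hΩ ihm.1 ihm.2 i⟩

end

end CliffordAnalysis


theorem mainTheorem10 (n : ℕ)
    (M : CliffordAnalysis.Cl n →L[ℝ] CliffordAnalysis.Cl n)
    (hM : ∀ (j : Fin n) (a : CliffordAnalysis.Cl n),
      M (CliffordAnalysis.e j * a) = CliffordAnalysis.e j * M a)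
    (Ω : Set (EuclideanSpace ℝ (Fin (n + 1)))) (hΩ : IsOpen Ω)
    (f : ℕ → EuclideanSpace ℝ (Fin (n + 1)) → CliffordAnalysis.Cl n)
    (g : EuclideanSpace ℝ (Fin (n + 1)) → CliffordAnalysis.Cl n)
    (hf : ∀ k, f k ∈ CliffordAnalysis.solutionSpace M Ω)
    (hfg : CliffordAnalysis.ConvergesUniformlyOnCompacts f g Ω) :
    g ∈ CliffordAnalysis.solutionSpace M Ω ∧
      (∀ k, ContDiffOn ℝ (⊤ : ℕ∞) (f k) Ω) ∧ ContDiffOn ℝ (⊤ : ℕ∞) g Ω ∧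
      ∀ β : Fin (n + 1) → ℕ,
        CliffordAnalysis.ConvergesUniformlyOnCompacts
          (fun k => CliffordAnalysis.multiDeriv β (f k)) (CliffordAnalysis.multiDeriv β g) Ω := by
  have hg := CliffordAnalysis.mem_solutionSpace_of_tendsto hM hΩ hf hfg
  exact ⟨hg, fun k => CliffordAnalysis.contDiffOn_of_mem_solutionSpace hM hΩ (hf k),
    CliffordAnalysis.contDiffOn_of_mem_solutionSpace hM hΩ hg, fun β =>
    (CliffordAnalysis.foldr_partialDeriv_convergesUniformlyOnCompacts hM hΩ β hf hfg
      (List.finRange (n + 1))).2⟩
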